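/- Let $G$ be a finite simple graph with non-empty vertex set $V$ (the agents), $n=|V|$, and adjacency matrix $(g_{ij})$. For an externality factor $\delta\in[0,1]$, the best response of agent $i$ to a profile $x\in[0,1]^V$ is $f_i(x)=\max\bigl(0,\,1-\delta\sum_{j}g_{ij}x_j\bigr)$. An equilibrium is a profile $x\in[0,1]^V$ with $x_i=f_i(x)$ for every $i$, and its active set is $\{i: x_i>0\}$. (The same notions apply to induced subgraphs.) In the random best-response dynamics started at $x(0)\in[0,1]^V$, in each period $t=1,2,\dots$ one agent $i$, drawn independently and uniformly from $V$, revises: $x_i(t)=f_i(x(t-1))$ and $x_j(t)=x_j(t-1)$ for $j\ne i$. An equilibrium $x^*$ is stable if (a) for every $\varepsilon>0$ there is $r>0$ such that for all $x(0)\in[0,1]^V$ with $\|x(0)-x^*\|_\infty<r$ we have $\mathbb P\bigl(\sup_{t>0}\|x(t)-x^*\|_\infty<\varepsilon\bigr)=1$, and (b) there is $\varepsilon>0$ such that for all $x(0)\in[0,1]^V$ with $\|x(0)-x^*\|_\infty<\varepsilon$ we have $\mathbb P\bigl(\lim_{t\to\infty}\|x(t)-x^*\|_\infty=0\bigr)=1$;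 otherwise it is unstable. Theorem. Let $S\subseteq V$, let $(S_l)$ be the vertex sets of the connected components of the subgraph induced by $S$, and let $\lambda_{\min}(G_{S_l})$ be the smallest eigenvalue of the adjacency matrix of the subgraph induced by $S_l$. Here $1/0=+\infty$ in conditions 1 and 3. (i) Let $\delta\in[0,1]$ and suppose that 1. $\delta<1/|\lambda_{\min}(G_{S_l})|$ for every $l$. Then there is a unique $x^*\in\mathbb R^V$ that vanishes outside $S$ and restricts, for each $l$, to an equilibrium of the game on the subgraph induced by $S_l$. If moreover 2. $x^*_i>0$ for all $i\in S$, and 3. $\sum_j g_{ij}x^*_j>1/\delta$ for all $i\notin S$, then $x^*$ is a stable equilibrium of the game on $G$ with active set $S$. (ii) For all but finitely many $\delta\in[0,1]$: if condition 1 fails, then every equilibrium of the game on $G$ with active set $S$ is unstable. -/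

import Mathlib

open MeasureTheory Filter Topology

noncomputable section

namespace NetworkGame

/-- The set `[0,1]^W` of strategy profiles of the agents in `W`. -/
def Profiles (W : Type*) : Set (W → ℝ) :=
  {x | ∀ i, x i ∈ Set.Icc (0 : ℝ) 1}

open Classical in
/-- The weighted activity `δ * ∑ j, g i j * x j` of the neighbours of agent `i`. -/
def externality {W : Type*} [Fintype W] (G : SimpleGraph W) (δ : ℝ) (x : W → ℝ) (i : W) : ℝ :=
  δ * ∑ j, G.adjMatrix ℝ i j * x j

/-- The (linear) best response of agent `i` to the profile `x`. It does not depend on `x i`, as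
`g i i = 0`. -/
def bestResponse {W : Type*} [Fintype W] (G : SimpleGraph W) (δ : ℝ) (x : W → ℝ) (i : W) : ℝ :=
  max 0 (1 - externality G δ x i)

/-- Equilibria of the game with linear best responses: profiles in which every agent plays the best
response to the activity of the others. -/
def IsEquilibrium {W : Type*} [Fintype W] (G : SimpleGraph W) (δ : ℝ) (x : W → ℝ) : Prop :=
  x ∈ Profiles W ∧ ∀ i, x i = bestResponse G δ x i

open Classical in
/-- The payoff `x i - (x i) ^ 2 / 2 - δ * ∑ j, g i j * x i * x j` of agent `i`. -/
def payoff {W : Type*} [Fintype W] (G : SimpleGraph W) (δ : ℝ) (x : W → ℝ) (i : W) : ℝ :=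
  x i - x i ^ 2 / 2 - δ * ∑ j, G.adjMatrix ℝ i j * x i * x j

open Classical in
/-- Equilibria are the Nash equilibria for the above payoffs. -/
theorem isEquilibrium_iff_nash {W : Type*} [Fintype W] (G : SimpleGraph W) {δ : ℝ} (hδ : 0 ≤ δ)
    (x : W → ℝ) :
    IsEquilibrium G δ x ↔ x ∈ Profiles W ∧ ∀ i, ∀ y ∈ Set.Icc (0 : ℝ) 1,
      payoff G δ (Function.update x i y) i - payoff G δ x i ≤ 0 := by
  refine and_congr_right fun hx => forall_congr' fun i => ?_
  have he : 0 ≤ externality G δ x i := by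
    refine mul_nonneg hδ (Finset.sum_nonneg fun j _ => mul_nonneg ?_ (hx j).1)
    by_cases h : G.Adj i j <;> simp [SimpleGraph.adjMatrix_apply, h]
  have key : ∀ y : ℝ, payoff G δ (Function.update x i y) i
      = y - y ^ 2 / 2 - y * externality G δ x i := by
    intro y
    simp only [payoff, externality, Function.update_self]
    congr 1
    rw [mul_left_comm y δ]
    congr 1
    rw [Finset.mul_sum]
    refine Finset.sum_congr rfl fun j _ => ?_
    by_cases hj : j = i
    · subst hj; simp [SimpleGraph.adjMatrix_apply]
    · rw [Function.update_of_ne hj]; ring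
  have key' : payoff G δ x i = x i - x i ^ 2 / 2 - x i * externality G δ x i := by
    have := key (x i)
    rwa [Function.update_eq_self] at this
  have hxi := hx i
  simp only [key, key', bestResponse]
  generalize externality G δ x i = e at *
  generalize x i = a at *
  obtain ⟨h0, h1⟩ := hxi
  constructor
  · rintro h y ⟨hy0, hy1⟩
    rcases le_total 0 (1 - e) with h' | h'
    · rw [max_eq_right h'] at h
      nlinarith [sq_nonneg (y - a)]
    · rw [max_eq_left h'] at h
      subst h
      nlinarith [sq_nonneg y, mul_nonneg hy0 (neg_nonneg.2 h')]
  · intro h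
    rcases le_total 0 (1 - e) with h' | h'
    · rw [max_eq_right h']
      have := h (1 - e) ⟨h', by linarith⟩
      nlinarith [sq_nonneg (a - (1 - e))]
    · rw [max_eq_left h']
      have := h 0 ⟨le_rfl, zero_le_one⟩
      nlinarith [sq_nonneg a, mul_nonneg h0 (neg_nonneg.2 h')]

/-- The set of agents with positive activity. -/
def activeSet {W : Type*} (x : W → ℝ) : Set W :=
  {i | 0 < x i}

open Classical in
/-- The smallest eigenvalue of the adjacency matrix of `G`. -/
def lambdaMin {W : Type*} [Fintype W] (G : SimpleGraph W) : ℝ :=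
  sInf (spectrum ℝ (G.adjMatrix ℝ))

/-- The vertex set, as a set of vertices of `G`, of a connected component of the subgraph of `G`
induced by `S`. -/
def componentSet {V : Type*} (G : SimpleGraph V) (S : Set V)
    (C : (G.induce S).ConnectedComponent) : Set V :=
  Subtype.val '' C.supp

open Classical in
/-- `δ < 1 / |λ_min(G_{S_l})|` for each connected component `S_l` of the subgraph induced by `S`.
It is written without the quotient, so that it holds for a one-vertex component, where the smallest
eigenvalue is `0` and the bound is `+∞`. -/
def EigenvalueCondition {V : Type*} [Fintype V] (G : SimpleGraph V) (S : Set V) (δ : ℝ) : Prop :=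
  ∀ C : (G.induce S).ConnectedComponent,
    δ * |lambdaMin (G.induce (componentSet G S C))| < 1

open Classical in
/-- `x` vanishes outside `S`, and its restriction to each connected component `S_l` of the subgraph
induced by `S` is an equilibrium of the game on `G_{S_l}`. -/
def IsComponentwiseEquilibrium {V : Type*} [Fintype V] (G : SimpleGraph V) (S : Set V) (δ : ℝ)
    (x : V → ℝ) : Prop :=
  (∀ i, i ∉ S → x i = 0) ∧
    ∀ C : (G.induce S).ConnectedComponent,
      IsEquilibrium (G.induce (componentSet G S C)) δ
        (fun v : componentSet G S C => x (v : V))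

open Classical in
/-- The random best-response dynamics: `picks t` is the agent who revises in period `t + 1`, and
`trajectory G δ x₀ picks t` is the profile `x(t)`, started at `x(0) = x₀`. -/
def trajectory {V : Type*} [Fintype V] (G : SimpleGraph V) (δ : ℝ) (x₀ : V → ℝ) (picks : ℕ → V) :
    ℕ → V → ℝ
  | 0 => x₀
  | t + 1 => Function.update (trajectory G δ x₀ picks t) (picks t)
      (bestResponse G δ (trajectory G δ x₀ picks t) (picks t))

/-- The sigma-algebra on sequences of agents that is generated by the coordinates, the set of agents
being discrete. -/
abbrev picksMeasurableSpace (V : Type*) : MeasurableSpace (ℕ → V) :=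
  @MeasurableSpace.pi ℕ (fun _ => V) (fun _ => ⊤)

/-- The law of the sequence of revising agents: independent and uniformly distributed on `V`. -/
def picksMeasure (V : Type*) [Fintype V] [Nonempty V] :
    @Measure (ℕ → V) (picksMeasurableSpace V) :=
  letI : MeasurableSpace V := ⊤
  Measure.infinitePi (fun _ : ℕ => (PMF.uniformOfFintype V).toMeasure)

/-- Almost sure Lyapunov stability of `x` under the best-response dynamics (sup norm). -/
def IsLyapunovStable {V : Type*} [Fintype V] [Nonempty V] (G : SimpleGraph V) (δ : ℝ)
    (x : V → ℝ) : Prop :=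
  ∀ ε : ℝ, 0 < ε → ∃ r : ℝ, 0 < r ∧ ∀ x₀ ∈ Profiles V, ‖x₀ - x‖ < r →
    ∀ᵐ picks ∂(picksMeasure V), (⨆ t : ℕ, ‖trajectory G δ x₀ picks (t + 1) - x‖) < ε

/-- Attractiveness of `x` under the best-response dynamics (sup norm). -/
def IsAttractive {V : Type*} [Fintype V] [Nonempty V] (G : SimpleGraph V) (δ : ℝ)
    (x : V → ℝ) : Prop :=
  ∃ ε : ℝ, 0 < ε ∧ ∀ x₀ ∈ Profiles V, ‖x₀ - x‖ < ε →
    ∀ᵐ picks ∂(picksMeasure V),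
      Tendsto (fun t : ℕ => ‖trajectory G δ x₀ picks t - x‖) atTop (𝓝 0)

/-- Local asymptotic stability in probability; an equilibrium is unstable if it is not stable. -/
def IsStable {V : Type*} [Fintype V] [Nonempty V] (G : SimpleGraph V) (δ : ℝ)
    (x : V → ℝ) : Prop :=
  IsLyapunovStable G δ x ∧ IsAttractive G δ x

end NetworkGame

end

noncomputable section

namespace NetworkGame

/-! The game has a quadratic potential Φ(x) = xᵀ(1 + δA)x − 2∑ xᵢ. In each coordinate it is a
parabola whose minimum over [0, ∞) is the best response, so every revision lowers Φ by at least the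
square of the step (`potential_update_bestResponse_le`). Condition 1 says that 1 + δA is positive
definite on vectors supported on S, because its quadratic form splits over the components of S.

Minimizing Φ over the profiles supported on S gives an equilibrium on the components, and positive
definiteness makes the gradient strictly monotone there, hence uniqueness. For stability, the key
inequality is ⟨y − x, ∇Φ(y)⟩ > 0 for all profiles y ≠ x near x: the quadratic form handles the
directions inside S, and the strict first-order term handles those outside. It makes x both a strict
local minimizer of Φ and the only equilibrium nearby. A potential barrier around x then traps
trajectories. By Borel–Cantelli, almost surely all agents revise within infinitely many windows of
bounded length. Steps tend to 0, so a limit point along such windows is an equilibrium, hence x.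
Thus Φ tends to Φ(x), and strict minimality gives convergence.

If instead δ|λ_min| > 1 on some component, an eigenvector extended by zero is a direction along
which Φ drops below Φ(x). Trajectories started there keep Φ below Φ(x) and cannot converge to x.
Only the finitely many borderline δ with δ|λ_min| = 1 escape this dichotomy. -/

theorem update_mem_profiles {W : Type*} [DecidableEq W] {x : W → ℝ} (hx : x ∈ Profiles W) (i : W) {a : ℝ}
    (ha : a ∈ Set.Icc (0 : ℝ) 1) : Function.update x i a ∈ Profiles W := by
  intro j
  by_cases h : j = i
  · subst h; simpa using ha
  · simpa [h] using hx j

/-! ### The potential and its behaviour under best responses -/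

section Algebra

variable {W : Type*} [Fintype W] (G : SimpleGraph W) (δ : ℝ)

theorem externality_add (x y : W → ℝ) (i : W) :
    externality G δ (x + y) i = externality G δ x i + externality G δ y i := by
  simp only [externality, Pi.add_apply, mul_add, Finset.sum_add_distrib]

theorem externality_smul (c : ℝ) (x : W → ℝ) (i : W) :
    externality G δ (c • x) i = c * externality G δ x i := by
  simp only [externality, Pi.smul_apply, smul_eq_mul, Finset.mul_sum]
  exact Finset.sum_congr rfl fun j _ => by ring

theorem externality_sub (x y : W → ℝ) (i : W) :
    externality G δ (x - y) i = externality G δ x i - externality G δ y i := by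
  simp only [externality, Pi.sub_apply, mul_sub, Finset.sum_sub_distrib]

open Classical in
theorem externality_single (d : ℝ) (i : W) : externality G δ (Pi.single i d) i = 0 := by
  simp [externality, Pi.single_apply, SimpleGraph.adjMatrix_apply]

theorem sum_mul_externality_comm (x y : W → ℝ) :
    ∑ i, x i * externality G δ y i = ∑ i, y i * externality G δ x i := by
  simp only [externality, Finset.mul_sum]
  rw [Finset.sum_comm]
  refine Finset.sum_congr rfl fun i _ => Finset.sum_congr rfl fun j _ => ?_
  have hji := G.adj_comm j i
  by_cases h : G.Adj i j
  · simp only [SimpleGraph.adjMatrix_apply, hji, h, if_true]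
    ring
  · simp [SimpleGraph.adjMatrix_apply, hji, h]

theorem continuous_externality (i : W) : Continuous fun x : W → ℝ => externality G δ x i := by
  unfold externality
  fun_prop

theorem continuous_bestResponse (i : W) : Continuous fun x : W → ℝ => bestResponse G δ x i :=
  continuous_const.max (continuous_const.sub (continuous_externality G δ i))

variable {G δ}

theorem externality_nonneg (hδ : 0 ≤ δ) {x : W → ℝ} (hx : x ∈ Profiles W) (i : W) :
    0 ≤ externality G δ x i := by
  refine mul_nonneg hδ (Finset.sum_nonneg fun j _ => mul_nonneg ?_ (hx j).1)
  rw [SimpleGraph.adjMatrix_apply]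
  split_ifs <;> norm_num

open Classical in
theorem abs_externality_le (hδ : δ ∈ Set.Icc (0 : ℝ) 1) (z : W → ℝ) (i : W) :
    |externality G δ z i| ≤ Fintype.card W * ‖z‖ := by
  rw [externality, abs_mul, abs_of_nonneg hδ.1]
  refine (mul_le_of_le_one_left (abs_nonneg _) hδ.2).trans ?_
  refine (Finset.abs_sum_le_sum_abs _ _).trans ?_
  have : ∀ j ∈ Finset.univ, |G.adjMatrix ℝ i j * z j| ≤ ‖z‖ := by
    intro j _
    have h := norm_le_pi_norm z j
    rw [Real.norm_eq_abs] at h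
    rw [SimpleGraph.adjMatrix_apply]
    split_ifs
    · simpa using h
    · simp
  simpa using Finset.sum_le_card_nsmul _ _ _ this

theorem abs_bestResponse_sub_le (hδ : δ ∈ Set.Icc (0 : ℝ) 1) (x y : W → ℝ) (i : W) :
    |bestResponse G δ x i - bestResponse G δ y i| ≤ Fintype.card W * ‖x - y‖ := by
  refine le_trans ?_ (abs_externality_le (G := G) hδ (x - y) i)
  rw [bestResponse, bestResponse, max_comm, max_comm 0, externality_sub,
    abs_sub_comm (externality G δ x i)]
  refine (abs_max_sub_max_le_abs _ _ _).trans_eq ?_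
  congr 1
  ring

theorem bestResponse_mem (hδ : 0 ≤ δ) {x : W → ℝ} (hx : x ∈ Profiles W) (i : W) :
    bestResponse G δ x i ∈ Set.Icc (0 : ℝ) 1 :=
  ⟨le_max_left _ _, max_le zero_le_one (by linarith [externality_nonneg (G := G) hδ hx i])⟩

variable (G δ)

/-- The quadratic form of the matrix `1 + δ * A`, where `A` is the adjacency matrix of `G`. -/
def quadForm (z : W → ℝ) : ℝ := ∑ i, z i * (z i + externality G δ z i)

/-- Half the gradient of the potential of the game. -/
def marginal (x : W → ℝ) (i : W) : ℝ := x i + externality G δ x i - 1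

/-- A potential of the game: along every coordinate it is minimized by the best response. -/
def potential (x : W → ℝ) : ℝ := quadForm G δ x - 2 * ∑ i, x i

theorem continuous_potential : Continuous (potential G δ) := by
  unfold potential quadForm
  have := continuous_externality G δ
  fun_prop

theorem quadForm_smul (c : ℝ) (z : W → ℝ) : quadForm G δ (c • z) = c ^ 2 * quadForm G δ z := by
  simp only [quadForm, Finset.mul_sum, externality_smul, Pi.smul_apply, smul_eq_mul]
  exact Finset.sum_congr rfl fun j _ => by ring

theorem potential_add (x z : W → ℝ) :
    potential G δ (x + z) = potential G δ x + 2 * ∑ i, z i * marginal G δ x i + quadForm G δ z := by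
  have h := sum_mul_externality_comm G δ x z
  simp only [potential, quadForm, marginal, externality_add, Pi.add_apply, mul_add, add_mul, mul_sub,
    Finset.sum_add_distrib, Finset.sum_sub_distrib, mul_one] at *
  have h' : ∑ i, x i * z i = ∑ i, z i * x i := Finset.sum_congr rfl fun i _ => mul_comm _ _
  linarith

theorem sum_mul_marginal_add (x z : W → ℝ) :
    ∑ i, z i * marginal G δ (x + z) i = ∑ i, z i * marginal G δ x i + quadForm G δ z := by
  rw [quadForm, ← Finset.sum_add_distrib]
  refine Finset.sum_congr rfl fun i _ => ?_
  rw [marginal, marginal, externality_add, Pi.add_apply]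
  ring

open Classical in
theorem potential_update (x : W → ℝ) (i : W) (a : ℝ) :
    potential G δ (Function.update x i a)
      = potential G δ x + 2 * (a - x i) * marginal G δ x i + (a - x i) ^ 2 := by
  have hx : Function.update x i a = x + Pi.single i (a - x i) := by
    ext j
    by_cases h : j = i
    · subst h; simp
    · simp [h]
  have h1 : ∑ j, (Pi.single i (a - x i) : W → ℝ) j * marginal G δ x j
      = (a - x i) * marginal G δ x i := by
    rw [Finset.sum_eq_single i (fun j _ hj => by simp [hj]) (by simp), Pi.single_eq_same]
  have h2 : quadForm G δ (Pi.single i (a - x i)) = (a - x i) ^ 2 := by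
    rw [quadForm, Finset.sum_eq_single i (fun j _ hj => by simp [hj]) (by simp),
      externality_single, Pi.single_eq_same]
    ring
  rw [hx, potential_add, h1, h2]
  ring

variable {G δ}

open Classical in
-- The coordinate parabola has leading coefficient 1. An interior best response is its vertex,
-- giving equality; at a response clipped to 0 the slope there is nonnegative, so the drop is at
-- least as large.
theorem potential_update_bestResponse_le {x : W → ℝ} (hx : x ∈ Profiles W) (i : W) :
    potential G δ (Function.update x i (bestResponse G δ x i))
      ≤ potential G δ x - (bestResponse G δ x i - x i) ^ 2 := by
  rw [potential_update, bestResponse, marginal]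
  have h0 := (hx i).1
  rcases le_total 0 (1 - externality G δ x i) with h | h
  · rw [max_eq_right h]
    nlinarith
  · rw [max_eq_left h]
    nlinarith

/-- First-order condition for minimizing Φ over `0 ≤ x i`: the marginal vanishes at an unclipped
response, and is nonnegative where the response is 0. -/
theorem bestResponse_complementarity {x : W → ℝ} {i : W} (h : x i = bestResponse G δ x i) {y : ℝ}
    (hy : 0 ≤ y) : 0 ≤ (y - x i) * marginal G δ x i := by
  rw [bestResponse] at h
  rw [marginal]
  rcases le_total 0 (1 - externality G δ x i) with h' | h'
  · rw [max_eq_right h'] at h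
    rw [h]; simp
  · rw [max_eq_left h'] at h
    rw [h]; nlinarith

theorem marginal_eq_zero_of_pos {x : W → ℝ} {i : W} (h : x i = bestResponse G δ x i)
    (hpos : 0 < x i) : marginal G δ x i = 0 := by
  rw [bestResponse] at h
  rcases max_choice 0 (1 - externality G δ x i) with h' | h' <;> rw [h'] at h
  · exact absurd h hpos.ne'
  · rw [marginal, h]
    ring

theorem isCompact_profiles {W : Type*} : IsCompact (Profiles W) := by
  have : Profiles W = Set.pi Set.univ fun _ => Set.Icc (0 : ℝ) 1 := by
    ext x; simp only [Profiles, Set.mem_ofPred_eq, Set.mem_pi, Set.mem_univ, true_imp_iff]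
  rw [this]
  exact isCompact_univ_pi fun _ => isCompact_Icc

end Algebra

/-! ### Splitting along the connected components of the induced subgraph -/

section Components

theorem sum_coe_eq_sum {V M : Type*} [Fintype V] [AddCommMonoid M] (T : Set V) [Fintype T]
    {f : V → M} (hf : ∀ i, i ∉ T → f i = 0) : ∑ w : T, f w = ∑ i, f i := by
  classical
  rw [← Finset.sum_subtype {i | i ∈ T} (by simp) f]
  exact Finset.sum_subset (Finset.subset_univ _) fun i _ hi => hf i (by simpa using hi)

theorem mem_componentSet_iff {V : Type*} {G : SimpleGraph V} {S : Set V}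
    {C : (G.induce S).ConnectedComponent} {i : V} :
    i ∈ componentSet G S C ↔ ∃ h : i ∈ S, (G.induce S).connectedComponentMk ⟨i, h⟩ = C := by
  simp [componentSet, SimpleGraph.ConnectedComponent.mem_supp_iff]

theorem componentSet_subset {V : Type*} {G : SimpleGraph V} {S : Set V}
    (C : (G.induce S).ConnectedComponent) : componentSet G S C ⊆ S := fun _ hi =>
  (mem_componentSet_iff.1 hi).1

theorem mem_componentSet_of_adj {V : Type*} {G : SimpleGraph V} {S : Set V}
    {C : (G.induce S).ConnectedComponent} {i j : V}
    (hi : i ∈ componentSet G S C) (hj : j ∈ S) (h : G.Adj i j) : j ∈ componentSet G S C := by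
  rw [mem_componentSet_iff] at *
  obtain ⟨hiS, rfl⟩ := hi
  refine ⟨hj, SimpleGraph.ConnectedComponent.sound (SimpleGraph.Adj.reachable ?_)⟩
  simpa using h.symm

theorem nonempty_componentSet {V : Type*} {G : SimpleGraph V} {S : Set V}
    (C : (G.induce S).ConnectedComponent) : Nonempty (componentSet G S C) := by
  obtain ⟨v, rfl⟩ := C.exists_rep
  exact ⟨⟨v, mem_componentSet_iff.2 ⟨v.2, rfl⟩⟩⟩

variable {V : Type*} [Fintype V] {G : SimpleGraph V} {S : Set V} {δ : ℝ}

open Classical in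
theorem externality_induce (T : Set V) [Fintype T] {x : V → ℝ} (i : T)
    (hx : ∀ j, j ∉ T → G.Adj i j → x j = 0) :
    externality (G.induce T) δ (fun v : T => x v) i = externality G δ x i := by
  simp only [externality, SimpleGraph.adjMatrix_apply, SimpleGraph.comap_adj,
    Function.Embedding.subtype_apply]
  rw [sum_coe_eq_sum T (f := fun j => (if G.Adj i j then (1 : ℝ) else 0) * x j)]
  intro j hj
  by_cases h : G.Adj i j
  · simp [hx j hj h]
  · simp [h]

/-- No edge leaves a component inside S, and vertices outside S contribute 0. -/
theorem externality_induce_componentSet {C : (G.induce S).ConnectedComponent}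
    [Fintype (componentSet G S C)] {x : V → ℝ} (hx : ∀ i, i ∉ S → x i = 0)
    (i : componentSet G S C) :
    externality (G.induce (componentSet G S C)) δ (fun v : componentSet G S C => x v) i
      = externality G δ x i :=
  externality_induce _ i fun j hj hij => hx j fun hjS => hj (mem_componentSet_of_adj i.2 hjS hij)

/-- On profiles that vanish outside `S`, the equilibria on the components are the profiles at which
every agent of `S` plays the best response in `G`. -/
theorem isComponentwiseEquilibrium_iff {V : Type*} [Fintype V] {G : SimpleGraph V} {S : Set V}
    {δ : ℝ} {x : V → ℝ} :
    IsComponentwiseEquilibrium G S δ x ↔ (∀ i, i ∉ S → x i = 0) ∧ x ∈ Profiles V ∧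
      ∀ i ∈ S, x i = bestResponse G δ x i := by
  classical
  refine and_congr_right fun h0 => ?_
  constructor
  · intro h
    have h' : ∀ i ∈ S, x i ∈ Set.Icc (0 : ℝ) 1 ∧ x i = bestResponse G δ x i := by
      intro i hi
      have hC := (mem_componentSet_iff (G := G)).2 ⟨hi, rfl⟩
      refine ⟨(h _).1 ⟨i, hC⟩, ?_⟩
      have := (h _).2 ⟨i, hC⟩
      rwa [bestResponse, externality_induce_componentSet h0] at this
    refine ⟨fun i => ?_, fun i hi => (h' i hi).2⟩
    by_cases hi : i ∈ S
    · exact (h' i hi).1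
    · rw [h0 i hi]; simp
  · rintro ⟨hx, h⟩ C
    refine ⟨fun i => hx i, fun i => ?_⟩
    rw [bestResponse, externality_induce_componentSet h0]
    exact h i (componentSet_subset C i.2)

open Classical in
theorem quadForm_eq_sum_componentSet {u : V → ℝ} (hu : ∀ i, i ∉ S → u i = 0) :
    quadForm G δ u = ∑ C : (G.induce S).ConnectedComponent,
      quadForm (G.induce (componentSet G S C)) δ (fun v : componentSet G S C => u v) := by
  have h : ∀ C : (G.induce S).ConnectedComponent,
      quadForm (G.induce (componentSet G S C)) δ (fun v : componentSet G S C => u v)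
        = ∑ i, if i ∈ componentSet G S C then u i * (u i + externality G δ u i) else 0 := by
    intro C
    rw [← sum_coe_eq_sum (componentSet G S C) fun i hi => if_neg hi]
    refine Finset.sum_congr rfl fun i _ => ?_
    rw [if_pos i.2, externality_induce_componentSet hu]
  simp only [h]
  rw [Finset.sum_comm]
  refine Finset.sum_congr rfl fun i _ => ?_
  by_cases hi : i ∈ S
  · rw [Finset.sum_eq_single ((G.induce S).connectedComponentMk ⟨i, hi⟩),
      if_pos (mem_componentSet_iff.2 ⟨hi, rfl⟩)]
    · intro C _ hC
      rw [if_neg]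
      rintro hiC
      obtain ⟨_, h⟩ := mem_componentSet_iff.1 hiC
      exact hC h.symm
    · simp
  · simp [hu i hi]

end Components

/-! ### The smallest adjacency eigenvalue and the quadratic form -/

section Spectrum

variable {W : Type*} [Fintype W] (G : SimpleGraph W)

open Classical in
theorem finite_spectrum_adjMatrix : (spectrum ℝ (G.adjMatrix ℝ)).Finite := by
  have hA : (G.adjMatrix ℝ).IsHermitian := by
    rw [Matrix.IsHermitian, Matrix.conjTranspose_eq_transpose_of_trivial]
    exact SimpleGraph.isSymm_adjMatrix G
  rw [hA.spectrum_real_eq_range_eigenvalues]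
  exact Set.finite_range _

open Classical in
theorem posSemidef_adjMatrix_sub_lambdaMin :
    (G.adjMatrix ℝ - algebraMap ℝ _ (lambdaMin G)).PosSemidef := by
  have hA : (G.adjMatrix ℝ).IsHermitian := by
    rw [Matrix.IsHermitian, Matrix.conjTranspose_eq_transpose_of_trivial]
    exact SimpleGraph.isSymm_adjMatrix G
  rw [Matrix.posSemidef_iff_isHermitian_and_spectrum_nonneg]
  refine ⟨hA.sub ?_, ?_⟩
  · rw [Matrix.algebraMap_eq_diagonal]
    exact Matrix.isHermitian_diagonal _
  · rw [← spectrum.sub_singleton_eq]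
    rintro _ ⟨a, ha, b, rfl, rfl⟩
    exact sub_nonneg.2 (csInf_le (finite_spectrum_adjMatrix G).bddBelow ha)

theorem lambdaMin_mul_le_quadForm {δ : ℝ} (hδ : 0 ≤ δ) (u : W → ℝ) :
    (1 + δ * lambdaMin G) * ∑ i, u i ^ 2 ≤ quadForm G δ u := by
  classical
  have h := (posSemidef_adjMatrix_sub_lambdaMin G).dotProduct_mulVec_nonneg u
  have h' : quadForm G δ u = ∑ i, u i ^ 2 + δ * (u ⬝ᵥ (G.adjMatrix ℝ).mulVec u) := by
    simp only [quadForm, externality, dotProduct, Matrix.mulVec, Finset.mul_sum,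
      ← Finset.sum_add_distrib]
    refine Finset.sum_congr rfl fun i _ => ?_
    rw [mul_add, sq, Finset.mul_sum]
    congr 1
    refine Finset.sum_congr rfl fun j _ => ?_
    simp only [SimpleGraph.adjMatrix_apply]
    ring
  have h'' : (u ⬝ᵥ ((algebraMap ℝ (Matrix W W ℝ) (lambdaMin G)).mulVec u))
      = lambdaMin G * ∑ i, u i ^ 2 := by
    rw [Algebra.algebraMap_eq_smul_one, Matrix.smul_mulVec, Matrix.one_mulVec, dotProduct_smul,
      smul_eq_mul, dotProduct]
    simp only [sq]
  rw [star_trivial, Matrix.sub_mulVec, dotProduct_sub, h''] at h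
  simp only [SimpleGraph.adjMatrix] at *
  rw [h']
  nlinarith [mul_nonneg hδ h]

/-- The adjacency matrix has zero diagonal, so its Rayleigh quotient at a coordinate vector is 0.
This turns `|lambdaMin G|` into `-lambdaMin G`. -/
theorem lambdaMin_nonpos [Nonempty W] : lambdaMin G ≤ 0 := by
  classical
  obtain ⟨i⟩ := ‹Nonempty W›
  have h := lambdaMin_mul_le_quadForm G zero_le_one (Pi.single i 1)
  rw [quadForm, Finset.sum_eq_single i (fun j _ hj => by simp [hj]) (by simp),
    Finset.sum_eq_single i (fun j _ hj => by simp [hj]) (by simp), externality_single,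
    Pi.single_eq_same] at h
  linarith

theorem exists_eigenvector_lambdaMin [Nonempty W] (δ : ℝ) :
    ∃ u : W → ℝ, u ≠ 0 ∧ ∀ i, externality G δ u i = δ * lambdaMin G * u i := by
  classical
  have hA : (G.adjMatrix ℝ).IsHermitian := by
    rw [Matrix.IsHermitian, Matrix.conjTranspose_eq_transpose_of_trivial]
    exact SimpleGraph.isSymm_adjMatrix G
  have hne : (spectrum ℝ (G.adjMatrix ℝ)).Nonempty := by
    rw [hA.spectrum_real_eq_range_eigenvalues]
    exact Set.range_nonempty _
  have hmem := hne.csInf_mem (finite_spectrum_adjMatrix G)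
  rw [← Matrix.spectrum_toLin', ← Module.End.hasEigenvalue_iff_mem_spectrum] at hmem
  obtain ⟨u, hu⟩ := hmem.exists_hasEigenvector
  refine ⟨u, hu.2, fun i => ?_⟩
  have h := congrFun hu.apply_eq_smul i
  rw [Matrix.toLin'_apply, Pi.smul_apply, smul_eq_mul] at h
  rw [mul_assoc, lambdaMin]
  rw [Matrix.spectrum_toLin'] at h
  rw [← h]
  rfl

end Spectrum

/-- The matrix `1 + δ * A_S` of the subgraph induced by `S` is positive definite. -/
theorem quadForm_pos_of_eigenvalueCondition {V : Type*} [Fintype V] {G : SimpleGraph V}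
    {S : Set V} {δ : ℝ} (hδ : 0 ≤ δ) (h : EigenvalueCondition G S δ) {u : V → ℝ}
    (hu : ∀ i, i ∉ S → u i = 0) (hu0 : u ≠ 0) : 0 < quadForm G δ u := by
  classical
  have hpos : ∀ C : (G.induce S).ConnectedComponent,
      0 < 1 + δ * lambdaMin (G.induce (componentSet G S C)) := fun C => by
    nlinarith [h C, neg_abs_le (lambdaMin (G.induce (componentSet G S C)))]
  rw [quadForm_eq_sum_componentSet hu]
  obtain ⟨i, hi⟩ := Function.ne_iff.1 hu0
  have hiS : i ∈ S := by
    by_contra hiS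
    exact hi (hu i hiS)
  refine Finset.sum_pos' (fun C _ => le_trans ?_ (lambdaMin_mul_le_quadForm _ hδ _))
    ⟨(G.induce S).connectedComponentMk ⟨i, hiS⟩, Finset.mem_univ _,
      lt_of_lt_of_le ?_ (lambdaMin_mul_le_quadForm _ hδ _)⟩
  · exact mul_nonneg (hpos C).le (Finset.sum_nonneg fun _ _ => sq_nonneg _)
  · have : u i ≠ 0 := hi
    exact mul_pos (hpos _) (Finset.sum_pos' (fun _ _ => sq_nonneg _)
      ⟨⟨i, mem_componentSet_iff.2 ⟨hiS, rfl⟩⟩, Finset.mem_univ _, by positivity⟩)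

/-! ### Existence, uniqueness and local variational inequalities -/

section Equilibrium

variable {V : Type*} [Fintype V] {G : SimpleGraph V} {S : Set V} {δ : ℝ}

theorem exists_isComponentwiseEquilibrium (hδ : 0 ≤ δ) :
    ∃ x : V → ℝ, IsComponentwiseEquilibrium G S δ x := by
  classical
  have hK : IsCompact (Profiles V ∩ {x | ∀ i, i ∉ S → x i = 0}) := by
    refine isCompact_profiles.inter_right ?_
    simp only [Set.ofPred_forall]
    exact isClosed_iInter fun i => isClosed_iInter fun _ =>
      isClosed_eq (continuous_apply i) continuous_const
  obtain ⟨x, ⟨hx, hx0⟩, hmin⟩ := hK.exists_isMinOn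
    ⟨0, fun i => by simp, fun i _ => rfl⟩ (continuous_potential G δ).continuousOn
  refine ⟨x, isComponentwiseEquilibrium_iff.2 ⟨hx0, hx, fun i hi => ?_⟩⟩
  -- Revising an agent of S stays in the constraint set, so the minimizer forces the guaranteed
  -- drop, the squared step, to be 0.
  have h1 := potential_update_bestResponse_le (G := G) (δ := δ) hx i
  have h2 : potential G δ x ≤ potential G δ (Function.update x i (bestResponse G δ x i)) := by
    refine hmin ⟨update_mem_profiles hx i (bestResponse_mem hδ hx i), fun j hj => ?_⟩
    have : j ≠ i := fun h => hj (h ▸ hi)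
    simpa [this] using hx0 j hj
  have h3 : (bestResponse G δ x i - x i) ^ 2 = 0 := le_antisymm (by linarith) (sq_nonneg _)
  linarith [pow_eq_zero_iff two_ne_zero |>.1 h3]

theorem IsComponentwiseEquilibrium.unique
    (hpos : ∀ u : V → ℝ, (∀ i, i ∉ S → u i = 0) → u ≠ 0 → 0 < quadForm G δ u) {x y : V → ℝ}
    (hx : IsComponentwiseEquilibrium G S δ x) (hy : IsComponentwiseEquilibrium G S δ y) :
    y = x := by
  obtain ⟨hx0, hxP, hx⟩ := isComponentwiseEquilibrium_iff.1 hx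
  obtain ⟨hy0, hyP, hy⟩ := isComponentwiseEquilibrium_iff.1 hy
  by_contra hne
  have h := hpos (y - x) (fun i hi => by simp [hx0 i hi, hy0 i hi]) (sub_ne_zero.2 hne)
  have h1 := sum_mul_marginal_add G δ x (y - x)
  rw [add_sub_cancel] at h1
  have h2 : 0 ≤ ∑ i, (y - x) i * marginal G δ x i := Finset.sum_nonneg fun i _ => by
    by_cases hi : i ∈ S
    · exact bestResponse_complementarity (hx i hi) (hyP i).1
    · simp [hx0 i hi, hy0 i hi]
  have h3 : ∑ i, (y - x) i * marginal G δ y i ≤ 0 := Finset.sum_nonpos fun i _ => by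
    by_cases hi : i ∈ S
    · have := bestResponse_complementarity (hy i hi) (hxP i).1
      rw [Pi.sub_apply]
      linarith
    · simp [hx0 i hi, hy0 i hi]
  linarith

theorem quadForm_add (u w : V → ℝ) :
    quadForm G δ (u + w)
      = quadForm G δ u + 2 * ∑ i, w i * (u i + externality G δ u i) + quadForm G δ w := by
  have h := sum_mul_externality_comm G δ u w
  simp only [quadForm, externality_add, Pi.add_apply, mul_add, add_mul,
    Finset.sum_add_distrib] at *
  have h' : ∑ i, u i * w i = ∑ i, w i * u i := Finset.sum_congr rfl fun i _ => mul_comm _ _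
  linarith

/-- Near an equilibrium with positive definite active part and strict inequalities outside the
active set, the directional derivative of the potential away from the equilibrium is positive. -/
theorem exists_ball_sum_mul_marginal_pos
    (hpos : ∀ u : V → ℝ, (∀ i, i ∉ S → u i = 0) → u ≠ 0 → 0 < quadForm G δ u) {x : V → ℝ}
    (hx0 : ∀ i, i ∉ S → x i = 0) (hxS : ∀ i ∈ S, marginal G δ x i = 0)
    (hxN : ∀ i, i ∉ S → 0 < marginal G δ x i) :
    ∃ ε : ℝ, 0 < ε ∧ ∀ y ∈ Profiles V, ‖y - x‖ ≤ ε → y ≠ x →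
      0 < ∑ i, (y - x) i * marginal G δ y i := by
  classical
  -- The displacement z is split into its part u on S and its part w off S. As x vanishes off S, w
  -- is nonnegative, and its first-order gain dominates the cross terms when z is small.
  let u : (V → ℝ) → V → ℝ := fun z i => if i ∈ S then z i else 0
  let w : (V → ℝ) → V → ℝ := fun z i => if i ∈ S then 0 else z i
  have hu : Continuous u := continuous_pi fun i => by
    by_cases hi : i ∈ S <;> simp only [u, hi, if_true, if_false] <;> fun_prop
  have hw : Continuous w := continuous_pi fun i => by
    by_cases hi : i ∈ S <;> simp only [w, hi, if_true, if_false] <;> fun_prop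
  have hu0 : u 0 = 0 := by ext i; simp [u]
  have hw0 : w 0 = 0 := by ext i; simp [w]
  have he0 : ∀ i, externality G δ 0 i = 0 := fun i => by simp [externality]
  have hev : ∀ᶠ z in 𝓝 (0 : V → ℝ), ∀ i, i ∉ S →
      0 < marginal G δ x i + 2 * externality G δ (u z) i + externality G δ (w z) i + w z i := by
    rw [eventually_all]
    intro i
    by_cases hi : i ∈ S
    · exact Eventually.of_forall fun _ h => absurd hi h
    · have hc : Continuous fun z => marginal G δ x i + 2 * externality G δ (u z) i
          + externality G δ (w z) i + w z i :=
        ((continuous_const.add (continuous_const.mul ((continuous_externality G δ i).comp hu))).add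
          ((continuous_externality G δ i).comp hw)).add ((continuous_apply i).comp hw)
      refine (hc.continuousAt.eventually (lt_mem_nhds (a := 0) ?_)).mono fun z hz _ => hz
      simpa [hu0, hw0, he0] using hxN i hi
  obtain ⟨ε, hε, hball⟩ := Metric.nhds_basis_closedBall.eventually_iff.1 hev
  refine ⟨ε, hε, fun y hy hyε hne => ?_⟩
  have hz := hball (x := y - x) (by simpa using hyε)
  have hzN : ∀ i, i ∉ S → 0 ≤ (y - x) i := fun i hi => by simpa [hx0 i hi] using (hy i).1
  have hz0 : y - x ≠ 0 := sub_ne_zero.2 hne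
  have hsplit := sum_mul_marginal_add G δ x (y - x)
  rw [add_sub_cancel] at hsplit
  rw [hsplit]
  generalize y - x = z at *
  have huw : z = u z + w z := by
    ext i
    by_cases hi : i ∈ S <;> simp [u, w, hi]
  have key : ∑ i, z i * marginal G δ x i + quadForm G δ z = quadForm G δ (u z) + ∑ i, w z i *
      (marginal G δ x i + 2 * externality G δ (u z) i + externality G δ (w z) i + w z i) := by
    have hq : quadForm G δ z = quadForm G δ (u z + w z) := by rw [← huw]
    rw [hq, quadForm_add, add_left_comm, add_assoc, quadForm, quadForm, Finset.mul_sum,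
      ← Finset.sum_add_distrib, ← Finset.sum_add_distrib]
    congr 1
    refine Finset.sum_congr rfl fun i _ => ?_
    by_cases hi : i ∈ S
    · simp [w, hi, hxS i hi]
    · simp only [u, w, hi, if_false]
      ring
  rw [key]
  have hterm : ∀ i, 0 ≤ w z i *
      (marginal G δ x i + 2 * externality G δ (u z) i + externality G δ (w z) i + w z i) := by
    intro i
    by_cases hi : i ∈ S
    · simp [w, hi]
    · exact mul_nonneg (by simpa [w, hi] using hzN i hi) (hz i hi).le
  by_cases huz : u z = 0
  · obtain ⟨i, hi⟩ := Function.ne_iff.1 hz0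
    have hiS : i ∉ S := fun hiS => hi (by simpa [u, hiS] using congrFun huz i)
    refine add_pos_of_nonneg_of_pos (by simp [huz, quadForm]) (Finset.sum_pos' (fun i _ => hterm i)
      ⟨i, Finset.mem_univ i, mul_pos ?_ (hz i hiS)⟩)
    simpa [w, hiS] using lt_of_le_of_ne (hzN i hiS) (Ne.symm hi)
  · exact add_pos_of_pos_of_nonneg (hpos _ (fun i hi => by simp [u, hi]) huz)
      (Finset.sum_nonneg fun i _ => hterm i)

theorem IsEquilibrium.sum_mul_marginal_nonneg {x : V → ℝ} (hx : IsEquilibrium G δ x) {y : V → ℝ}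
    (hy : y ∈ Profiles V) : 0 ≤ ∑ i, (y - x) i * marginal G δ x i :=
  Finset.sum_nonneg fun i _ => bestResponse_complementarity (hx.2 i) (hy i).1

/-- As Φ is quadratic, Φ(y) − Φ(x) is the sum of the pairings of y − x with the marginals at x and
at y; the first is nonnegative at an equilibrium. -/
theorem IsEquilibrium.potential_lt {x : V → ℝ} (hx : IsEquilibrium G δ x) {y : V → ℝ}
    (hy : y ∈ Profiles V) (h : 0 < ∑ i, (y - x) i * marginal G δ y i) :
    potential G δ x < potential G δ y := by
  have h1 := sum_mul_marginal_add G δ x (y - x)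
  have h2 := potential_add G δ x (y - x)
  rw [add_sub_cancel] at h1 h2
  linarith [hx.sum_mul_marginal_nonneg hy]

theorem IsEquilibrium.eq_of_sum_mul_marginal_pos {x y : V → ℝ} (hx : x ∈ Profiles V)
    (hy : IsEquilibrium G δ y) (h : y ≠ x → 0 < ∑ i, (y - x) i * marginal G δ y i) : y = x := by
  by_contra hne
  have h1 := hy.sum_mul_marginal_nonneg hx
  rw [← neg_sub y x] at h1
  simp only [Pi.neg_apply, neg_mul, Finset.sum_neg_distrib] at h1
  linarith [h hne]

end Equilibrium

/-! ### Trapping and convergence of trajectories -/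

section Dynamics

variable {V : Type*} [Fintype V] {G : SimpleGraph V} {δ : ℝ}

theorem trajectory_mem_profiles (hδ : 0 ≤ δ) {x₀ : V → ℝ} (hx₀ : x₀ ∈ Profiles V)
    (picks : ℕ → V) (t : ℕ) : trajectory G δ x₀ picks t ∈ Profiles V := by
  classical
  induction t with
  | zero => exact hx₀
  | succ t ih => exact update_mem_profiles ih _ (bestResponse_mem hδ ih _)

theorem trajectory_succ_apply (x₀ : V → ℝ) (picks : ℕ → V) (t : ℕ) :
    trajectory G δ x₀ picks (t + 1) (picks t)
      = bestResponse G δ (trajectory G δ x₀ picks t) (picks t) := by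
  simp [trajectory]

theorem trajectory_succ_apply_of_ne (x₀ : V → ℝ) (picks : ℕ → V) (t : ℕ) {i : V}
    (hi : i ≠ picks t) :
    trajectory G δ x₀ picks (t + 1) i = trajectory G δ x₀ picks t i := by
  simp [trajectory, hi]

theorem potential_trajectory_succ_le (hδ : 0 ≤ δ) {x₀ : V → ℝ} (hx₀ : x₀ ∈ Profiles V)
    (picks : ℕ → V) (t : ℕ) :
    potential G δ (trajectory G δ x₀ picks (t + 1)) ≤ potential G δ (trajectory G δ x₀ picks t)
      - ‖trajectory G δ x₀ picks (t + 1) - trajectory G δ x₀ picks t‖ ^ 2 := by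
  have h := potential_update_bestResponse_le (G := G) (δ := δ)
    (x := trajectory G δ x₀ picks t) (trajectory_mem_profiles hδ hx₀ picks t) (picks t)
  refine h.trans (sub_le_sub_left ?_ _)
  rw [← sq_abs (bestResponse _ _ _ _ - _)]
  refine pow_le_pow_left₀ (norm_nonneg _) ((pi_norm_le_iff_of_nonneg (abs_nonneg _)).2 ?_) 2
  intro i
  by_cases hi : i = picks t
  · subst hi
    rw [Pi.sub_apply, trajectory_succ_apply, Real.norm_eq_abs]
  · rw [Pi.sub_apply, trajectory_succ_apply_of_ne x₀ picks t hi, sub_self, norm_zero]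
    exact abs_nonneg _

theorem antitone_potential_trajectory (hδ : 0 ≤ δ) {x₀ : V → ℝ} (hx₀ : x₀ ∈ Profiles V)
    (picks : ℕ → V) : Antitone fun t => potential G δ (trajectory G δ x₀ picks t) :=
  antitone_nat_of_succ_le fun t =>
    (potential_trajectory_succ_le hδ hx₀ picks t).trans (sub_le_self _ (sq_nonneg _))

theorem norm_trajectory_succ_sub_le (hδ : δ ∈ Set.Icc (0 : ℝ) 1) {x : V → ℝ}
    (hx : IsEquilibrium G δ x) (x₀ : V → ℝ) (picks : ℕ → V) (t : ℕ) :
    ‖trajectory G δ x₀ picks (t + 1) - x‖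
      ≤ (Fintype.card V + 1) * ‖trajectory G δ x₀ picks t - x‖ := by
  have h0 : 0 ≤ (Fintype.card V : ℝ) * ‖trajectory G δ x₀ picks t - x‖ := by positivity
  have h1 := norm_nonneg (trajectory G δ x₀ picks t - x)
  rw [add_mul, one_mul, pi_norm_le_iff_of_nonneg (by positivity)]
  intro i
  by_cases hi : i = picks t
  · subst hi
    rw [Pi.sub_apply, trajectory_succ_apply, hx.2 (picks t), Real.norm_eq_abs]
    linarith [abs_bestResponse_sub_le (G := G) hδ (trajectory G δ x₀ picks t) x (picks t)]
  · rw [Pi.sub_apply, trajectory_succ_apply_of_ne x₀ picks t hi]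
    have := norm_le_pi_norm (trajectory G δ x₀ picks t - x) i
    rw [Pi.sub_apply] at this
    linarith

/-- Trajectories that start near a strict local minimizer of the potential stay near it. -/
theorem exists_ball_trajectory_near (hδ : δ ∈ Set.Icc (0 : ℝ) 1) {x : V → ℝ}
    (hx : IsEquilibrium G δ x) {ε₀ : ℝ} (hε₀ : 0 < ε₀)
    (hmin : ∀ y ∈ Profiles V, ‖y - x‖ ≤ ε₀ → y ≠ x → potential G δ x < potential G δ y)
    {ε : ℝ} (hε : 0 < ε) :
    ∃ r : ℝ, 0 < r ∧ ∀ x₀ ∈ Profiles V, ‖x₀ - x‖ < r → ∀ picks : ℕ → V, ∀ t,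
      ‖trajectory G δ x₀ picks t - x‖ ≤ ε := by
  set ρ := min ε ε₀ with hρ
  have hρ0 : 0 < ρ := lt_min hε hε₀
  set K : ℝ := Fintype.card V + 1 with hK
  have hK1 : 1 ≤ K := by rw [hK]; linarith [Nat.cast_nonneg (α := ℝ) (Fintype.card V)]
  have hK0 : 0 < K := by linarith
  have hρK : 0 < ρ / K := by positivity
  have hnorm : Continuous fun y : V → ℝ => ‖y - x‖ := by fun_prop
  -- One revision expands the distance to x by at most K, so no trajectory jumps over this shell, on
  -- which Φ is at least some m > Φ(x). Starting with Φ < m prevents entering it.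
  have hshell : IsCompact (Profiles V ∩ {y | ‖y - x‖ ∈ Set.Icc (ρ / K) ρ}) :=
    isCompact_profiles.inter_right (isClosed_Icc.preimage hnorm)
  obtain ⟨m, hm, hmle⟩ := hshell.exists_forall_le' (continuous_potential G δ).continuousOn
    (a := potential G δ x) fun y hy => hmin y hy.1 (hy.2.2.trans (min_le_right _ _)) fun h => by
      have := hy.2.1
      rw [h, sub_self, norm_zero] at this
      linarith
  obtain ⟨r, hr, hrball⟩ := Metric.nhds_basis_ball.eventually_iff.1
    ((continuous_potential G δ).continuousAt.eventually (gt_mem_nhds hm))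
  refine ⟨min r (ρ / K), lt_min hr hρK, fun x₀ hx₀ hx₀r picks t => ?_⟩
  have h0 : potential G δ x₀ < m :=
    hrball (by simpa [dist_eq_norm] using hx₀r.trans_le (min_le_left _ _))
  have hlt : ‖trajectory G δ x₀ picks t - x‖ < ρ / K := by
    induction t with
    | zero => exact hx₀r.trans_le (min_le_right _ _)
    | succ t ih =>
      by_contra! hge
      have h1 : ‖trajectory G δ x₀ picks (t + 1) - x‖ ≤ ρ :=
        (norm_trajectory_succ_sub_le hδ hx x₀ picks t).trans
          ((mul_le_mul_of_nonneg_left ih.le hK0.le).trans_eq (by field_simp))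
      have h2 := hmle _ ⟨trajectory_mem_profiles hδ.1 hx₀ picks (t + 1), hge, h1⟩
      have h3 : potential G δ (trajectory G δ x₀ picks (t + 1)) ≤ potential G δ x₀ :=
        antitone_potential_trajectory hδ.1 hx₀ picks (Nat.zero_le (t + 1))
      linarith
  exact hlt.le.trans ((div_le_self hρ0.le hK1).trans (min_le_left _ _))

theorem exists_tendsto_potential_trajectory (hδ : 0 ≤ δ) {x₀ : V → ℝ} (hx₀ : x₀ ∈ Profiles V)
    (picks : ℕ → V) :
    ∃ p, Tendsto (fun t => potential G δ (trajectory G δ x₀ picks t)) atTop (𝓝 p) := by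
  obtain ⟨b, hb⟩ := isCompact_profiles.bddBelow_image (continuous_potential G δ).continuousOn
  refine ⟨_, tendsto_atTop_ciInf (antitone_potential_trajectory hδ hx₀ picks) ⟨b, ?_⟩⟩
  rintro _ ⟨t, rfl⟩
  exact hb ⟨_, trajectory_mem_profiles hδ hx₀ picks t, rfl⟩

theorem tendsto_norm_trajectory_succ_sub (hδ : 0 ≤ δ) {x₀ : V → ℝ} (hx₀ : x₀ ∈ Profiles V)
    (picks : ℕ → V) :
    Tendsto (fun t => ‖trajectory G δ x₀ picks (t + 1) - trajectory G δ x₀ picks t‖) atTop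
      (𝓝 0) := by
  obtain ⟨p, hp⟩ := exists_tendsto_potential_trajectory hδ hx₀ picks
  have h := hp.sub (hp.comp (tendsto_add_atTop_nat 1))
  rw [sub_self] at h
  have hsq := squeeze_zero (fun t => sq_nonneg
    ‖trajectory G δ x₀ picks (t + 1) - trajectory G δ x₀ picks t‖) (fun t => by
      have := potential_trajectory_succ_le (G := G) hδ hx₀ picks t
      show _ ≤ potential G δ (trajectory G δ x₀ picks t)
        - potential G δ (trajectory G δ x₀ picks (t + 1))
      linarith) h
  have := hsq.sqrt
  simpa [Real.sqrt_sq (norm_nonneg _)] using this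

theorem tendsto_norm_trajectory_add_sub (hδ : 0 ≤ δ) {x₀ : V → ℝ} (hx₀ : x₀ ∈ Profiles V)
    (picks : ℕ → V) (j : ℕ) :
    Tendsto (fun t => ‖trajectory G δ x₀ picks (t + j) - trajectory G δ x₀ picks t‖) atTop
      (𝓝 0) := by
  induction j with
  | zero => simp
  | succ j ih =>
    have h := ((tendsto_norm_trajectory_succ_sub (G := G) hδ hx₀ picks).comp
      (tendsto_add_atTop_nat j)).add ih
    rw [add_zero] at h
    refine squeeze_zero (fun _ => norm_nonneg _) (fun t => ?_) h
    exact norm_sub_le_norm_sub_add_norm_sub _ _ _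

/-- Along a trajectory in which, infinitely often, all agents revise within a window of bounded
length, every limit point through such windows is an equilibrium. -/
theorem isEquilibrium_of_tendsto_ultrafilter (hδ : δ ∈ Set.Icc (0 : ℝ) 1) {x₀ : V → ℝ}
    (hx₀ : x₀ ∈ Profiles V) (picks : ℕ → V) {N : ℕ} {U : Ultrafilter ℕ}
    (hU : ↑U ≤ (atTop : Filter ℕ))
    (hcov : ∀ᶠ t in (U : Filter ℕ), ∀ i, ∃ j < N, picks (t + j) = i) {y : V → ℝ}
    (hyP : y ∈ Profiles V)
    (hy : Tendsto (trajectory G δ x₀ picks) U (𝓝 y)) : IsEquilibrium G δ y := by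
  refine ⟨hyP, fun i => ?_⟩
  set X := trajectory G δ x₀ picks with hX
  -- For an agent revising at t + j, the residual at time t is bounded by the drift of the profile
  -- plus that of the best response, which is Lipschitz with constant `Fintype.card V`. Summing over
  -- j covers all agents.
  let E : ℕ → ℝ := fun t => ∑ j ∈ Finset.range N,
    (‖X (t + (j + 1)) - X t‖ + (Fintype.card V : ℝ) * ‖X (t + j) - X t‖)
  have hE : Tendsto E U (𝓝 0) := by
    have : Tendsto E atTop (𝓝 (∑ j ∈ Finset.range N, (0 + (Fintype.card V : ℝ) * 0))) :=
      tendsto_finsetSum _ fun j _ => (tendsto_norm_trajectory_add_sub hδ.1 hx₀ picks (j + 1)).add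
        ((tendsto_norm_trajectory_add_sub hδ.1 hx₀ picks j).const_mul _)
    simpa using this.mono_left hU
  have hR : Tendsto (fun t => |bestResponse G δ (X t) i - X t i|) U
      (𝓝 |bestResponse G δ y i - y i|) :=
    ((((continuous_bestResponse G δ i).sub (continuous_apply i)).abs).tendsto y).comp hy
  have hle : ∀ᶠ t in (U : Filter ℕ), |bestResponse G δ (X t) i - X t i| ≤ E t := by
    filter_upwards [hcov] with t ht
    obtain ⟨j, hj, rfl⟩ := ht i
    refine le_trans ?_ (Finset.single_le_sum (f := fun j => ‖X (t + (j + 1)) - X t‖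
      + (Fintype.card V : ℝ) * ‖X (t + j) - X t‖) (fun _ _ => by positivity)
      (Finset.mem_range.2 hj))
    have h1 := abs_bestResponse_sub_le (G := G) hδ (X (t + j)) (X t) (picks (t + j))
    have h2 := norm_le_pi_norm (X (t + (j + 1)) - X t) (picks (t + j))
    rw [Pi.sub_apply, ← add_assoc, hX, trajectory_succ_apply, Real.norm_eq_abs] at h2
    rw [abs_sub_comm] at h1
    refine (abs_sub_le _ (bestResponse G δ (X (t + j)) (picks (t + j))) _).trans ?_
    rw [add_comm ‖_‖]
    exact add_le_add h1 h2
  have h0 : |bestResponse G δ y i - y i| ≤ 0 := le_of_tendsto_of_tendsto hR hE hle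
  linarith [abs_nonpos_iff.1 h0]

theorem tendsto_trajectory_of_frequently_covered (hδ : δ ∈ Set.Icc (0 : ℝ) 1) {x : V → ℝ} {ε₀ : ℝ}
    (hmin : ∀ y ∈ Profiles V, ‖y - x‖ ≤ ε₀ → y ≠ x → potential G δ x < potential G δ y)
    (huniq : ∀ y, ‖y - x‖ ≤ ε₀ → IsEquilibrium G δ y → y = x)
    {x₀ : V → ℝ} (hx₀ : x₀ ∈ Profiles V) {picks : ℕ → V}
    (hstay : ∀ t, ‖trajectory G δ x₀ picks t - x‖ ≤ ε₀) {N : ℕ}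
    (hcov : ∃ᶠ t in atTop, ∀ i, ∃ j < N, picks (t + j) = i) :
    Tendsto (fun t => ‖trajectory G δ x₀ picks t - x‖) atTop (𝓝 0) := by
  have hnorm : Continuous fun y : V → ℝ => ‖y - x‖ := by fun_prop
  have hK : IsCompact (Profiles V ∩ {y | ‖y - x‖ ≤ ε₀}) :=
    isCompact_profiles.inter_right (isClosed_Iic.preimage hnorm)
  have hlim : ∀ U : Ultrafilter ℕ, ∃ y ∈ Profiles V ∩ {y | ‖y - x‖ ≤ ε₀},
      Tendsto (trajectory G δ x₀ picks) U (𝓝 y) := fun U => by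
    refine hK.ultrafilter_le_nhds (U.map (trajectory G δ x₀ picks)) ?_
    rw [le_principal_iff]
    exact mem_map.2 <| Eventually.of_forall fun t => ⟨trajectory_mem_profiles hδ.1 hx₀ picks t, hstay t⟩
  have hΦ : ∀ {U : Ultrafilter ℕ} {y : V → ℝ}, Tendsto (trajectory G δ x₀ picks) U (𝓝 y) →
      Tendsto (fun t => potential G δ (trajectory G δ x₀ picks t)) U (𝓝 (potential G δ y)) :=
    fun {_ y} h => ((continuous_potential G δ).tendsto y).comp h
  obtain ⟨p, hp⟩ := exists_tendsto_potential_trajectory (G := G) hδ.1 hx₀ picks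
  -- Covered windows are needed only here: a limit along them identifies the limit p of the whole
  -- monotone sequence of potentials.
  have hpx : p = potential G δ x := by
    have : NeBot (atTop ⊓ 𝓟 {t | ∀ i, ∃ j < N, picks (t + j) = i}) :=
      frequently_mem_iff_neBot.1 hcov
    have hU := Ultrafilter.of_le (atTop ⊓ 𝓟 {t | ∀ i, ∃ j < N, picks (t + j) = i})
    generalize Ultrafilter.of (atTop ⊓ 𝓟 {t | ∀ i, ∃ j < N, picks (t + j) = i}) = U at hU
    obtain ⟨y, ⟨hyP, hyε⟩, hy⟩ := hlim U
    have hyE := isEquilibrium_of_tendsto_ultrafilter hδ hx₀ picks (hU.trans inf_le_left)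
      (le_principal_iff.1 (hU.trans inf_le_right)) hyP hy
    rw [huniq y hyε hyE] at hy
    exact tendsto_nhds_unique (hp.mono_left (hU.trans inf_le_left)) (hΦ hy)
  have hconv : Tendsto (trajectory G δ x₀ picks) atTop (𝓝 x) := by
    rw [tendsto_iff_ultrafilter]
    intro U hU
    obtain ⟨y, ⟨hyP, hyε⟩, hy⟩ := hlim U
    have : y = x := by
      by_contra hne
      have h1 := hmin y hyP hyε hne
      rw [tendsto_nhds_unique (hΦ hy) (hp.mono_left hU), hpx] at h1
      exact lt_irrefl _ h1
    rwa [this] at hy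
  exact tendsto_iff_norm_sub_tendsto_zero.1 hconv

end Dynamics

/-! ### Recurrent windows in which every agent revises -/

section Measure

variable (V : Type*) [Fintype V] [Nonempty V]

instance isProbabilityMeasure_picksMeasure :
    @IsProbabilityMeasure _ (picksMeasurableSpace V) (picksMeasure V) := by
  let _ : MeasurableSpace V := ⊤
  unfold picksMeasure
  infer_instance

/-- Almost surely there are infinitely many windows of length `card V` in which everybody
revises. -/
theorem ae_frequently_forall_exists_pick :
    ∀ᵐ picks ∂(picksMeasure V), ∃ᶠ t in atTop, ∀ i, ∃ j < Fintype.card V, picks (t + j) = i := by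
  classical
  let _ : MeasurableSpace V := ⊤
  set N := Fintype.card V with hN
  have hN0 : 0 < N := Fintype.card_pos
  let e : Fin N ≃ V := (Fintype.equivFin V).symm
  -- `E k` asks that the agents revise in one fixed cyclic order during the k-th block. It has
  -- probability N^(−N), and disjoint blocks are independent, so the second Borel–Cantelli lemma
  -- applies.
  let T : ℕ → Set V := fun m => {e ⟨m % N, Nat.mod_lt m hN0⟩}
  let block : ℕ → Finset ℕ := fun k => Finset.Ico (k * N) (k * N + N)
  let E : ℕ → Set (ℕ → V) := fun k => Set.pi (block k) T
  let p : ENNReal := (N : ENNReal)⁻¹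
  have hμ : ∀ s : Finset ℕ, picksMeasure V (Set.pi s T) = p ^ s.card := fun s => by
    rw [picksMeasure, Measure.infinitePi_pi _ fun _ _ => MeasurableSet.of_discrete,
      Finset.prod_congr rfl fun m _ => ?_, Finset.prod_const]
    rw [PMF.toMeasure_apply_singleton _ _ (MeasurableSet.of_discrete),
      PMF.uniformOfFintype_apply]
  have hEm : ∀ k, MeasurableSet (E k) := fun k =>
    MeasurableSet.pi (block k).countable_toSet fun _ _ => MeasurableSet.of_discrete
  have hdisj : ∀ k l, k ≠ l → Disjoint (block k) (block l) := fun k l hkl => by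
    rw [Finset.disjoint_left]
    intro m hm hm'
    rw [Finset.mem_Ico] at hm hm'
    apply hkl
    rw [← Nat.div_eq_of_lt_le hm.1 (by rw [add_mul, one_mul]; exact hm.2),
      ← Nat.div_eq_of_lt_le hm'.1 (by rw [add_mul, one_mul]; exact hm'.2)]
  have hindep : ProbabilityTheory.iIndepSet E (picksMeasure V) := by
    rw [ProbabilityTheory.iIndepSet_iff_meas_biInter hEm]
    intro s
    have h : (⋂ k ∈ s, E k) = Set.pi (s.biUnion block) T := by
      ext f
      simp only [E, Set.mem_iInter, Set.mem_pi, Finset.mem_coe, Finset.mem_biUnion]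
      exact ⟨fun h m ⟨k, hk, hm⟩ => h k hk m hm, fun h k hk m hm => h m ⟨k, hk, hm⟩⟩
    rw [h, hμ, Finset.card_biUnion fun k _ l _ hkl => hdisj k l hkl, ← Finset.prod_pow_eq_pow_sum]
    exact Finset.prod_congr rfl fun k _ => (hμ _).symm
  have hsum : ∑' k, picksMeasure V (E k) = ⊤ := by
    have : ∀ k, picksMeasure V (E k) = p ^ N := fun k => by
      rw [hμ, Nat.card_Ico, Nat.add_sub_cancel_left]
    simp only [this]
    exact ENNReal.tsum_const_eq_top_of_ne_zero (pow_ne_zero _ (by simp [p]))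
  have h1 := ProbabilityTheory.measure_limsup_eq_one hEm hindep hsum
  have h2 := (mem_ae_iff_prob_eq_one (MeasurableSet.measurableSet_limsup hEm)).2 h1
  filter_upwards [h2] with picks hp
  rw [mem_limsup_iff_frequently_mem] at hp
  have ht : Tendsto (fun k => k * N) atTop atTop := tendsto_id.atTop_mul_const' hN0
  refine ht.frequently (hp.mono fun k hk i => ⟨e.symm i, (e.symm i).2, ?_⟩)
  have h3 := hk (k * N + e.symm i) (Finset.mem_coe.2 (Finset.mem_Ico.2
    ⟨Nat.le_add_right _ _, Nat.add_lt_add_left (e.symm i).2 _⟩))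
  have h4 : (k * N + (e.symm i : ℕ)) % N = e.symm i := by
    rw [Nat.mul_add_mod_self_right, Nat.mod_eq_of_lt (e.symm i).2]
  simpa [T, h4] using h3

end Measure

/-! ### Stability and instability criteria -/

section Stability

variable {V : Type*} [Fintype V] [Nonempty V] {G : SimpleGraph V} {S : Set V} {δ : ℝ}

theorem isStable_of_sum_mul_marginal_pos (hδ : δ ∈ Set.Icc (0 : ℝ) 1) {x : V → ℝ}
    (hx : IsEquilibrium G δ x) {ε₀ : ℝ} (hε₀ : 0 < ε₀)
    (h : ∀ y ∈ Profiles V, ‖y - x‖ ≤ ε₀ → y ≠ x → 0 < ∑ i, (y - x) i * marginal G δ y i) :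
    IsStable G δ x := by
  have hmin : ∀ y ∈ Profiles V, ‖y - x‖ ≤ ε₀ → y ≠ x → potential G δ x < potential G δ y :=
    fun y hy hyε hne => hx.potential_lt hy (h y hy hyε hne)
  have huniq : ∀ y, ‖y - x‖ ≤ ε₀ → IsEquilibrium G δ y → y = x := fun y hyε hy =>
    hy.eq_of_sum_mul_marginal_pos hx.1 (h y hy.1 hyε)
  constructor
  · intro ε hε
    -- The bound ε/2 keeps the supremum strictly below ε.
    obtain ⟨r, hr, hball⟩ := exists_ball_trajectory_near hδ hx hε₀ hmin (half_pos hε)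
    exact ⟨r, hr, fun x₀ hx₀ hx₀r => Eventually.of_forall fun picks =>
      (ciSup_le fun t => hball x₀ hx₀ hx₀r picks (t + 1)).trans_lt (half_lt_self hε)⟩
  · obtain ⟨r, hr, hball⟩ := exists_ball_trajectory_near hδ hx hε₀ hmin hε₀
    refine ⟨r, hr, fun x₀ hx₀ hx₀r => ?_⟩
    filter_upwards [ae_frequently_forall_exists_pick V] with picks hp
    exact tendsto_trajectory_of_frequently_covered hδ hmin huniq hx₀ (hball x₀ hx₀ hx₀r picks) hp

/-- An equilibrium from which the potential decreases along some admissible direction is not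
attractive. -/
theorem not_isAttractive_of_quadForm_neg (hδ : 0 ≤ δ) {x z : V → ℝ} (hx : IsEquilibrium G δ x)
    (hz : ∀ i, z i ≠ 0 → 0 < x i ∧ x i < 1) (hneg : quadForm G δ z < 0) :
    ¬ IsAttractive G δ x := by
  rintro ⟨ε, hε, h⟩
  have hmarginal : ∀ i, z i * marginal G δ x i = 0 := fun i => by
    by_cases hi : z i = 0
    · rw [hi, zero_mul]
    · rw [marginal_eq_zero_of_pos (hx.2 i) (hz i hi).1, mul_zero]
  have hc : Continuous fun s : ℝ => x + s • z := by fun_prop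
  have hev1 : ∀ᶠ s : ℝ in 𝓝 0, x + s • z ∈ Profiles V := by
    refine eventually_all.2 fun i => ?_
    by_cases hi : z i = 0
    · exact Eventually.of_forall fun s => by simpa [hi] using hx.1 i
    · have hci : Continuous fun s : ℝ => (x + s • z) i := (continuous_apply i).comp hc
      refine hci.continuousAt.eventually (Icc_mem_nhds ?_ ?_)
      · simpa using (hz i hi).1
      · simpa using (hz i hi).2
  have hev2 : ∀ᶠ s : ℝ in 𝓝 0, ‖x + s • z - x‖ < ε := by
    have hcn : Continuous fun s : ℝ => ‖x + s • z - x‖ := (hc.sub continuous_const).norm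
    exact hcn.continuousAt.eventually (gt_mem_nhds (by simpa using hε))
  obtain ⟨s, ⟨hs1, hs2⟩, hs0⟩ := (((hev1.and hev2).filter_mono nhdsWithin_le_nhds).and
    (self_mem_nhdsWithin : Set.Ioi (0 : ℝ) ∈ 𝓝[>] 0)).exists
  have hlt : potential G δ (x + s • z) < potential G δ x := by
    rw [potential_add, quadForm_smul, Finset.sum_eq_zero fun i _ => by
      rw [Pi.smul_apply, smul_eq_mul, mul_assoc, hmarginal i, mul_zero]]
    have hs0 : 0 < s := hs0
    nlinarith [mul_neg_of_pos_of_neg (pow_pos hs0 2) hneg]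
  -- One convergent sample suffices, since the potential is nonincreasing along every one.
  obtain ⟨picks, hp⟩ := (h _ hs1 hs2).exists
  have hconv := ((continuous_potential G δ).tendsto x).comp
    (tendsto_iff_norm_sub_tendsto_zero.2 hp)
  refine hlt.not_ge (le_of_tendsto hconv (Eventually.of_forall fun t => ?_))
  exact antitone_potential_trajectory hδ hs1 picks (Nat.zero_le t)

theorem externality_eq_zero_of_support {V : Type*} [Fintype V] {G : SimpleGraph V} {δ : ℝ}
    (hδ : 0 ≤ δ) {x z : V → ℝ} (hx : x ∈ Profiles V)
    (hz : ∀ j, z j ≠ 0 → 0 < x j) {i : V} (h : externality G δ x i = 0) :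
    externality G δ z i = 0 := by
  classical
  simp only [externality, Finset.mul_sum, SimpleGraph.adjMatrix_apply] at h ⊢
  rw [Finset.sum_eq_zero_iff_of_nonneg fun j _ => mul_nonneg hδ
    (mul_nonneg (by split_ifs <;> norm_num) (hx j).1)] at h
  refine Finset.sum_eq_zero fun j hj => ?_
  by_cases hzj : z j = 0
  · simp [hzj]
  · have h1 := h j hj
    rw [← mul_assoc, mul_eq_zero, or_iff_left (hz j hzj).ne'] at h1
    rw [← mul_assoc, h1, zero_mul]

theorem not_isStable_of_one_lt (hδ : 0 ≤ δ) {x : V → ℝ} (hx : IsEquilibrium G δ x)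
    (hS : activeSet x = S) {C : (G.induce S).ConnectedComponent} [Fintype (componentSet G S C)]
    (hC : 1 < δ * |lambdaMin (G.induce (componentSet G S C))|) : ¬ IsStable G δ x := by
  classical
  have := nonempty_componentSet C
  set L := lambdaMin (G.induce (componentSet G S C)) with hL
  have hneg : 1 + δ * L < 0 := by
    rw [abs_of_nonpos (lambdaMin_nonpos _)] at hC
    linarith
  obtain ⟨u, hu0, hu⟩ := exists_eigenvector_lambdaMin (G.induce (componentSet G S C)) δ
  let z : V → ℝ := fun i => if h : i ∈ componentSet G S C then u ⟨i, h⟩ else 0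
  have hzC : ∀ i, i ∉ componentSet G S C → z i = 0 := fun i hi => dif_neg hi
  have hzu : (fun v : componentSet G S C => z v) = u := by
    ext v
    exact dif_pos v.2
  have hzS : ∀ i, i ∉ S → z i = 0 := fun i hi => hzC i fun h => hi (componentSet_subset C h)
  have hext : ∀ v : componentSet G S C, externality G δ z v = δ * L * z v := fun v => by
    rw [← externality_induce_componentSet hzS, hzu, hu, ← hzu]
  have hxpos : ∀ i, z i ≠ 0 → 0 < x i := fun i hi => by
    have : i ∈ activeSet x := by
      rw [hS]
      by_contra h
      exact hi (hzS i h)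
    exact this
  refine fun hst => not_isAttractive_of_quadForm_neg hδ hx (z := z)
    (fun i hi => ⟨hxpos i hi, lt_of_le_of_ne (hx.1 i).2 fun h1 => ?_⟩) ?_ hst.2
  -- An agent playing 1 has zero externality from x, hence from z, whose support is active. The
  -- eigenvector equation with δL ≠ 0 then gives z i = 0, so z moves only coordinates strictly
  -- between 0 and 1.
  · have hiC : i ∈ componentSet G S C := by
      by_contra h
      exact hi (hzC i h)
    have h2 := hx.2 i
    have h3 : externality G δ x i = 0 := by
      have h4 := externality_nonneg (G := G) hδ hx.1 i
      rw [bestResponse, h1] at h2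
      rcases max_choice 0 (1 - externality G δ x i) with h | h <;> rw [h] at h2 <;> linarith
    have h5 := hext ⟨i, hiC⟩
    rw [externality_eq_zero_of_support hδ hx.1 hxpos h3] at h5
    have h6 : δ * L ≠ 0 := by linarith
    exact (mul_ne_zero h6 hi) h5.symm
  · have hq : quadForm G δ z = (1 + δ * L) * ∑ v, u v ^ 2 := by
      rw [quadForm, ← sum_coe_eq_sum (componentSet G S C) fun i hi => by simp [hzC i hi],
        Finset.mul_sum]
      refine Finset.sum_congr rfl fun v _ => ?_
      rw [hext, ← hzu]
      ring
    rw [hq]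
    obtain ⟨v, hv⟩ := Function.ne_iff.1 hu0
    have hv : u v ≠ 0 := hv
    exact mul_neg_of_neg_of_pos hneg (Finset.sum_pos' (fun _ _ => sq_nonneg _)
      ⟨v, Finset.mem_univ v, by positivity⟩)

end Stability

end NetworkGame

end

/-! ### The main theorem -/

open NetworkGame

theorem mainTheorem3 {V : Type*} [Fintype V] [Nonempty V] (G : SimpleGraph V) (S : Set V) :
    (∀ δ ∈ Set.Icc (0 : ℝ) 1, NetworkGame.EigenvalueCondition G S δ →
      (∃! x : V → ℝ, NetworkGame.IsComponentwiseEquilibrium G S δ x) ∧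
      ∀ x : V → ℝ, NetworkGame.IsComponentwiseEquilibrium G S δ x →
        (∀ i ∈ S, 0 < x i) →
        (∀ i, i ∉ S → 1 < NetworkGame.externality G δ x i) →
        NetworkGame.IsEquilibrium G δ x ∧ NetworkGame.activeSet x = S ∧
          NetworkGame.IsStable G δ x) ∧
    (∃ F : Set ℝ, F.Finite ∧ ∀ δ ∈ Set.Icc (0 : ℝ) 1, δ ∉ F →
      ¬ NetworkGame.EigenvalueCondition G S δ →
      ∀ x : V → ℝ, NetworkGame.IsEquilibrium G δ x → NetworkGame.activeSet x = S →
        ¬ NetworkGame.IsStable G δ x) := by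
  classical
  refine ⟨fun δ hδ hcond => ?_, ?_⟩
  · have hpos : ∀ u : V → ℝ, (∀ i, i ∉ S → u i = 0) → u ≠ 0 → 0 < quadForm G δ u :=
      fun u => quadForm_pos_of_eigenvalueCondition hδ.1 hcond
    refine ⟨?_, fun x hx hxS hxN => ?_⟩
    · obtain ⟨x, hx⟩ := exists_isComponentwiseEquilibrium (G := G) (S := S) hδ.1
      exact ⟨x, hx, fun y hy => hx.unique hpos hy⟩
    · obtain ⟨hx0, hxP, hxE⟩ := isComponentwiseEquilibrium_iff.1 hx
      have hxeq : IsEquilibrium G δ x := by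
        refine ⟨hxP, fun i => ?_⟩
        by_cases hi : i ∈ S
        · exact hxE i hi
        · rw [hx0 i hi, bestResponse, max_eq_left (by linarith [hxN i hi])]
      obtain ⟨ε, hε, h⟩ := exists_ball_sum_mul_marginal_pos hpos hx0
        (fun i hi => marginal_eq_zero_of_pos (hxE i hi) (hxS i hi))
        (fun i hi => by rw [marginal, hx0 i hi]; linarith [hxN i hi])
      refine ⟨hxeq, ?_, isStable_of_sum_mul_marginal_pos hδ hxeq hε h⟩
      ext i
      refine ⟨fun hi => ?_, hxS i⟩
      by_contra hiS
      exact (show 0 < x i from hi).ne' (hx0 i hiS)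
  -- These are the borderline values δ|λ_min| = 1. A component with λ_min = 0 contributes the
  -- harmless value 0⁻¹ = 0.
  · refine ⟨Set.range fun C : (G.induce S).ConnectedComponent =>
      |lambdaMin (G.induce (componentSet G S C))|⁻¹, Set.finite_range _, ?_⟩
    intro δ hδ hF hcond x hx hS
    obtain ⟨C, hC⟩ := not_forall.1 hcond
    refine not_isStable_of_one_lt hδ.1 hx hS (C := C)
      (lt_of_le_of_ne (not_lt.1 hC) fun h1 => hF ⟨C, ?_⟩)
    exact (eq_inv_of_mul_eq_one_left h1.symm).symm
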